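/- For a real sequence $(x_k)_{k\ge 0}$ and integers $j,k\ge 0$ put $$\nabla^j x_k:=\sum_{i=0}^{j}(-1)^i\binom{j}{i}x_{k+i}.$$ Let $\mathcal M_\infty$ be the set of completely monotone sequences normalised to start with $1$, i.e. of all real sequences $(x_k)_{k\ge 0}$ with $x_0=1$, $x_1<1$ and $\nabla^j x_k\ge 0$ for all $k,j\ge 0$. Let $\mathcal{LM}_\infty$ be the set of completely log-monotone sequences starting with $1$, i.e. of all strictly positive sequences $(x_k)_{k\ge 0}$ with $x_0=1$, $x_1<1$ and $\nabla^j \ln x_k\ge 0$ for all $k\ge 0$ and all $j\ge 1$. A probability measure $\kappa$ on $[0,\infty]$ is called infinitely divisible if for every $n\ge 2$ there are $n$ independent and identically distributed $[0,\infty]$-valued random variables whose sum has law $\kappa$. **Proposition.** Let $(b_k)_{k\ge 0}$ be a sequence of strictly positive real numbers. The following statements are equivalent. (i) $(b_k)_{k\ge 0}\in\mathcal{LM}_\infty$. (ii) There is an infinitely divisible probability measure $\kappa$ on $[0,\infty]$ with $\kappa(\{0\})<1$ and $\kappa(\{\infty\})<1$ such that $$b_k=\int_{[0,\infty]}e^{-kx}\,\kappa(dx)\qquad\text{for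 all } k\ge 0,$$ with the conventions $0\cdot\infty=0$ and $e^{-\infty}=0$. (iii) $(b_k^{\,r})_{k\ge 0}\in\mathcal M_\infty$ for every real $r>0$. (iv) $(b_k^{1/n})_{k\ge 0}\in\mathcal M_\infty$ for every integer $n\ge 1$. -/

import Mathlib

open MeasureTheory ProbabilityTheory
open scoped ENNReal

noncomputable section

/-- The iterated difference
`∇^j x_k = ∑_{i=0}^{j} (-1)^i (j choose i) x_{k+i}` of a real sequence. -/
def nablaIter (x : ℕ → ℝ) (j k : ℕ) : ℝ :=
  ∑ i ∈ Finset.range (j + 1), (-1 : ℝ) ^ i * (j.choose i : ℝ) * x (k + i)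

/-- A sequence is completely monotone if `∇^j x_k ≥ 0` for all `k, j ≥ 0`. -/
def IsCompletelyMonotoneSeq (x : ℕ → ℝ) : Prop :=
  ∀ k j : ℕ, 0 ≤ nablaIter x j k

/-- The set `M_∞` of completely monotone sequences with `x_0 = 1` and `x_1 < 1`. -/
def CMSeq : Set (ℕ → ℝ) :=
  {x | x 0 = 1 ∧ x 1 < 1 ∧ IsCompletelyMonotoneSeq x}

/-- The set `LM_∞` of completely log-monotone sequences: strictly positive sequences with
`x_0 = 1`, `x_1 < 1` and `∇^j (ln x)_k ≥ 0` for all `k ≥ 0` and all `j ≥ 1`. -/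
def LogCMSeq : Set (ℕ → ℝ) :=
  {x | (∀ k, 0 < x k) ∧ x 0 = 1 ∧ x 1 < 1 ∧
    ∀ k j : ℕ, 1 ≤ j → 0 ≤ nablaIter (fun m => Real.log (x m)) j k}

/-- The function `x ↦ e^{-x}` on `[0, ∞]`, with `e^{-∞} = 0`. -/
def expNeg (x : ℝ≥0∞) : ℝ :=
  if x = ⊤ then 0 else Real.exp (-x.toReal)

/-- A probability law `κ` on `[0, ∞]` is infinitely divisible if for every `n ≥ 2` there are
`n` independent and identically distributed `[0, ∞]`-valued random variables, on some
probability space, whose sum has law `κ`. -/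
def IsInfDivLaw (κ : Measure ℝ≥0∞) : Prop :=
  ∀ n : ℕ, 2 ≤ n →
    ∃ (Ω : Type) (_ : MeasurableSpace Ω) (P : Measure Ω) (Y : Fin n → Ω → ℝ≥0∞),
      IsProbabilityMeasure P ∧
      (∀ i, Measurable (Y i)) ∧
      iIndepFun Y P ∧
      (∀ i j, IdentDistrib (Y i) (Y j) P P) ∧
      P.map (fun ω => ∑ i, Y i ω) = κ

end

open Filter Topology Polynomial unitInterval

/-! ### Iterated differences -/

/-! Logarithms and powers are linked by two limits. Products of completely monotone sequences are
completely monotone (a discrete Leibniz rule), hence so are exponentials by the power series, and `b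
^ r = exp (r * log b)`. Conversely `log b` is the limit of `n * (b ^ (1 / n) - 1)`, and differences
of positive order do not see the constant.

The probabilistic side is Hausdorff's theorem: completely monotone sequences starting with `1` are
moment sequences on `[0, 1]`, that is, by `t = e^{-x}`, Laplace transforms on `[0, ∞]` sampled at
the integers. Independence turns sums into products of transforms, and moments determine the law, so
`n`-th roots of `b` correspond to `n`-fold decompositions of `κ`. Finally `b 1 < 1` and `0 < b 1`
say that `κ` is not the point mass at `0` or at `∞`. -/

/-- The linear functional on polynomials sending `X ^ k` to `x k`. -/
noncomputable def momentFunctional (x : ℕ → ℝ) : ℝ[X] →ₗ[ℝ] ℝ :=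
  Polynomial.lsum fun k => x k • LinearMap.id

lemma momentFunctional_monomial (x : ℕ → ℝ) (k : ℕ) (c : ℝ) :
    momentFunctional x (monomial k c) = x k * c := by
  simp [momentFunctional, Polynomial.sum_monomial_index]

lemma one_sub_X_pow_eq_sum (j : ℕ) :
    (1 - X : ℝ[X]) ^ j = ∑ i ∈ Finset.range (j + 1), monomial i ((-1 : ℝ) ^ i * (j.choose i : ℝ)) := by
  rw [sub_eq_add_neg, add_comm, add_pow]
  refine Finset.sum_congr rfl fun i _ => ?_
  rw [neg_pow, ← C_mul_X_pow_eq_monomial]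
  simp
  ring

/-- Identities between iterated differences thus become polynomial identities. -/
lemma momentFunctional_X_pow_mul_one_sub_X_pow (x : ℕ → ℝ) (j k : ℕ) :
    momentFunctional x (X ^ k * (1 - X) ^ j) = nablaIter x j k := by
  rw [one_sub_X_pow_eq_sum, Finset.mul_sum, map_sum, nablaIter]
  refine Finset.sum_congr rfl fun i _ => ?_
  rw [← monomial_one_right_eq_X_pow, monomial_mul_monomial, momentFunctional_monomial]
  ring

lemma nablaIter_zero (x : ℕ → ℝ) (k : ℕ) : nablaIter x 0 k = x k := by
  simp [nablaIter]

lemma nablaIter_succ (x : ℕ → ℝ) (j k : ℕ) :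
    nablaIter x (j + 1) k = nablaIter x j k - nablaIter x j (k + 1) := by
  simp only [← momentFunctional_X_pow_mul_one_sub_X_pow, ← map_sub]
  congr 1
  ring

lemma nablaIter_shift (x : ℕ → ℝ) (j k : ℕ) :
    nablaIter (fun m => x (m + 1)) j k = nablaIter x j (k + 1) := by
  simp only [nablaIter, add_right_comm]

lemma nablaIter_add (x y : ℕ → ℝ) (j k : ℕ) :
    nablaIter (fun m => x m + y m) j k = nablaIter x j k + nablaIter y j k := by
  simp only [nablaIter, mul_add, Finset.sum_add_distrib]

lemma nablaIter_const_mul (c : ℝ) (x : ℕ → ℝ) (j k : ℕ) :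
    nablaIter (fun m => c * x m) j k = c * nablaIter x j k := by
  simp only [nablaIter, Finset.mul_sum]
  exact Finset.sum_congr rfl fun i _ => by ring

lemma nablaIter_sub_shift (x : ℕ → ℝ) (j k : ℕ) :
    nablaIter (fun m => x m - x (m + 1)) j k = nablaIter x (j + 1) k := by
  rw [nablaIter_succ, ← nablaIter_shift]
  simp only [nablaIter, mul_sub, Finset.sum_sub_distrib]

lemma nablaIter_const (c : ℝ) {j : ℕ} (hj : 1 ≤ j) (k : ℕ) :
    nablaIter (fun _ => c) j k = 0 := by
  obtain ⟨j, rfl⟩ := Nat.exists_eq_add_of_le' hj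
  rw [nablaIter_succ, ← nablaIter_shift, sub_self]

lemma tendsto_nablaIter {ι : Type*} {l : Filter ι} {u : ι → ℕ → ℝ} {x : ℕ → ℝ}
    (h : ∀ m, Tendsto (fun i => u i m) l (𝓝 (x m))) (j k : ℕ) :
    Tendsto (fun i => nablaIter (u i) j k) l (𝓝 (nablaIter x j k)) :=
  tendsto_finsetSum _ fun _ _ => (h _).const_mul _

/-! ### Sequences that are completely monotone up to a given order -/

/-- Complete monotonicity of the initial segment `x 0, …, x N`. -/
def IsCompletelyMonotoneUpTo (N : ℕ) (x : ℕ → ℝ) : Prop :=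
  ∀ k j : ℕ, k + j ≤ N → 0 ≤ nablaIter x j k

namespace IsCompletelyMonotoneUpTo

variable {N : ℕ} {x y : ℕ → ℝ}

lemma nonneg (h : IsCompletelyMonotoneUpTo N x) {k : ℕ} (hk : k ≤ N) : 0 ≤ x k := by
  simpa [nablaIter_zero] using h k 0 hk

lemma mono {M : ℕ} (h : IsCompletelyMonotoneUpTo N x) (hM : M ≤ N) :
    IsCompletelyMonotoneUpTo M x := fun k j hkj => h k j (hkj.trans hM)

lemma sub_shift (h : IsCompletelyMonotoneUpTo (N + 1) x) :
    IsCompletelyMonotoneUpTo N fun m => x m - x (m + 1) := fun k j hkj => by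
  rw [nablaIter_sub_shift]
  exact h k (j + 1) (by lia)

lemma shift (h : IsCompletelyMonotoneUpTo (N + 1) x) :
    IsCompletelyMonotoneUpTo N fun m => x (m + 1) := fun k j hkj => by
  rw [nablaIter_shift]
  exact h (k + 1) j (by lia)

lemma of_sub_shift (h0 : ∀ k ≤ N + 1, 0 ≤ x k)
    (h : IsCompletelyMonotoneUpTo N fun m => x m - x (m + 1)) :
    IsCompletelyMonotoneUpTo (N + 1) x := by
  rintro k (_ | j) hkj
  · rw [nablaIter_zero]
    exact h0 k hkj
  · rw [← nablaIter_sub_shift]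
    exact h k j (by lia)

lemma add (hx : IsCompletelyMonotoneUpTo N x) (hy : IsCompletelyMonotoneUpTo N y) :
    IsCompletelyMonotoneUpTo N fun m => x m + y m := fun k j hkj => by
  rw [nablaIter_add]
  exact add_nonneg (hx k j hkj) (hy k j hkj)

lemma const_mul {c : ℝ} (hc : 0 ≤ c) (hx : IsCompletelyMonotoneUpTo N x) :
    IsCompletelyMonotoneUpTo N fun m => c * x m := fun k j hkj => by
  rw [nablaIter_const_mul]
  exact mul_nonneg hc (hx k j hkj)

lemma const {c : ℝ} (hc : 0 ≤ c) : IsCompletelyMonotoneUpTo N fun _ => c := by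
  rintro k (_ | j) -
  · rwa [nablaIter_zero]
  · rw [nablaIter_const c (Nat.le_add_left 1 j)]

/-- Induction on the order, using `x m * y m - x (m + 1) * y (m + 1) = x m * (y m - y (m + 1)) + (x
m - x (m + 1)) * y (m + 1)`, whose factors are completely monotone up to order `N`. -/
lemma mul (hx : IsCompletelyMonotoneUpTo N x) (hy : IsCompletelyMonotoneUpTo N y) :
    IsCompletelyMonotoneUpTo N fun m => x m * y m := by
  induction N generalizing x y with
  | zero =>
    intro k j hkj
    obtain ⟨rfl, rfl⟩ : k = 0 ∧ j = 0 := by lia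
    rw [nablaIter_zero]
    exact mul_nonneg (hx.nonneg le_rfl) (hy.nonneg le_rfl)
  | succ N ih =>
    refine of_sub_shift (fun k hk => mul_nonneg (hx.nonneg hk) (hy.nonneg hk)) ?_
    convert (ih (hx.mono N.le_succ) hy.sub_shift).add (ih hx.sub_shift hy.shift) using 2 with m
    ring

lemma pow (hx : IsCompletelyMonotoneUpTo N x) (n : ℕ) :
    IsCompletelyMonotoneUpTo N fun m => x m ^ n := by
  induction n with
  | zero => simpa using const (N := N) zero_le_one
  | succ n ih => simpa only [pow_succ] using ih.mul hx

lemma sum {ι : Type*} (s : Finset ι) {u : ι → ℕ → ℝ}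
    (h : ∀ i ∈ s, IsCompletelyMonotoneUpTo N (u i)) :
    IsCompletelyMonotoneUpTo N fun m => ∑ i ∈ s, u i m := by
  classical
  induction s using Finset.induction_on with
  | empty => simpa using const (N := N) le_rfl
  | insert a s ha ih =>
    simp only [Finset.sum_insert ha]
    exact (h a (Finset.mem_insert_self a s)).add
      (ih fun i hi => h i (Finset.mem_insert_of_mem hi))

lemma exp (hx : IsCompletelyMonotoneUpTo N x) :
    IsCompletelyMonotoneUpTo N fun m => Real.exp (x m) := by
  intro k j hkj
  have hlim : ∀ m, Tendsto (fun n => ∑ i ∈ Finset.range n, ((i.factorial : ℝ))⁻¹ * x m ^ i) atTop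
      (𝓝 (Real.exp (x m))) := fun m => by
    have := (NormedSpace.expSeries_div_hasSum_exp (x m)).tendsto_sum_nat
    rw [← Real.exp_eq_exp_ℝ] at this
    simpa only [div_eq_inv_mul] using this
  refine ge_of_tendsto' (tendsto_nablaIter hlim j k) fun n => ?_
  exact sum (Finset.range n) (fun i _ => (hx.pow i).const_mul (by positivity)) k j hkj

end IsCompletelyMonotoneUpTo

/-- The exponential of a sequence with nonnegative differences of all positive orders is
completely monotone. -/
lemma isCompletelyMonotoneSeq_exp {y : ℕ → ℝ}
    (h : ∀ k j : ℕ, 1 ≤ j → 0 ≤ nablaIter y j k) :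
    IsCompletelyMonotoneSeq fun m => Real.exp (y m) := by
  intro k j
  -- `y` may tend to `-∞`, so no single shift makes it nonnegative everywhere. Only the terms up to
  -- `k + j` matter here, which is why monotonicity is truncated at a finite order; the factor `exp
  -- (-c)` later undoes the shift.
  obtain ⟨c, hc⟩ : ∃ c : ℝ, ∀ m ≤ k + j, 0 ≤ c + y m := by
    refine ⟨∑ m ∈ Finset.range (k + j + 1), |y m|, fun m hm => ?_⟩
    have := Finset.single_le_sum (f := fun m => |y m|) (fun _ _ => abs_nonneg _)
      (Finset.mem_range.2 (Nat.lt_succ_of_le hm))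
    have := neg_abs_le (y m)
    linarith
  have hcm : IsCompletelyMonotoneUpTo (k + j) fun m => c + y m := by
    rintro k' (_ | j') hkj
    · rw [nablaIter_zero]
      exact hc _ hkj
    · rw [nablaIter_add, nablaIter_const c (Nat.le_add_left 1 j'), zero_add]
      exact h k' _ (Nat.le_add_left 1 j')
  have := hcm.exp.const_mul (Real.exp_nonneg (-c)) k j le_rfl
  simpa only [← Real.exp_add, neg_add_cancel_left] using this

lemma rpow_mem_CMSeq_of_mem_LogCMSeq {b : ℕ → ℝ} (h : b ∈ LogCMSeq) {r : ℝ} (hr : 0 < r) :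
    (fun k => b k ^ r) ∈ CMSeq := by
  obtain ⟨hpos, h0, h1, hlog⟩ := h
  refine ⟨by simp [h0], Real.rpow_lt_one (hpos 1).le h1 hr, ?_⟩
  simp only [Real.rpow_def_of_pos (hpos _), mul_comm _ r]
  exact isCompletelyMonotoneSeq_exp fun k j hj => by
    rw [nablaIter_const_mul]
    exact mul_nonneg hr.le (hlog k j hj)

lemma mem_LogCMSeq_of_rpow_mem_CMSeq {b : ℕ → ℝ} (hb : ∀ k, 0 < b k)
    (h : ∀ n : ℕ, 1 ≤ n → (fun k => b k ^ (1 / (n : ℝ))) ∈ CMSeq) : b ∈ LogCMSeq := by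
  obtain ⟨h0, h1, -⟩ := by simpa using h 1 le_rfl
  refine ⟨hb, h0, h1, fun k j hj => ?_⟩
  have hinv : Tendsto (fun n : ℕ => 1 / ((n + 1 : ℕ) : ℝ)) atTop (𝓝[>] 0) := by
    refine tendsto_nhdsWithin_iff.2 ⟨?_, .of_forall fun n => Set.mem_Ioi.2 (by positivity)⟩
    exact_mod_cast tendsto_one_div_add_atTop_nhds_zero_nat (𝕜 := ℝ)
  have hlim : ∀ m, Tendsto (fun n : ℕ => (1 / ((n + 1 : ℕ) : ℝ))⁻¹ *
      (-1 + b m ^ (1 / ((n + 1 : ℕ) : ℝ)))) atTop (𝓝 (Real.log (b m))) := fun m => by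
    simpa only [Function.comp_def, sub_eq_neg_add] using
      (tendsto_rpow_sub_one_log (hb m)).comp hinv
  refine ge_of_tendsto' (tendsto_nablaIter hlim j k) fun n => ?_
  rw [nablaIter_const_mul, nablaIter_add, nablaIter_const _ hj, zero_add]
  exact mul_nonneg (by positivity) ((h (n + 1) (Nat.le_add_left 1 n)).2.2 k j)

/-! ### The Hausdorff moment problem -/

/-- Apply the moment functional to `X ^ m = X ^ m * (X + (1 - X)) ^ (N - m)`, expanded binomially.
For `m = 0` the weights sum to `x 0`. -/
lemma sum_choose_mul_nablaIter (x : ℕ → ℝ) {m N : ℕ} (h : m ≤ N) :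
    ∑ k ∈ Finset.range (N + 1), (N.choose k * nablaIter x (N - k) k) *
      ((k.choose m : ℝ) / N.choose m) = x m := by
  obtain ⟨n, rfl⟩ := Nat.exists_eq_add_of_le h
  have hx : x m = momentFunctional x (X ^ m * (X + (1 - X)) ^ n) := by
    rw [add_sub_cancel, one_pow, mul_one, ← monomial_one_right_eq_X_pow,
      momentFunctional_monomial, mul_one]
  have hne : (((m + n).choose m : ℕ) : ℝ) ≠ 0 :=
    Nat.cast_ne_zero.2 (Nat.choose_pos h).ne'
  -- The terms with `k < m` vanish because `k.choose m = 0`.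
  rw [hx, add_pow, Finset.mul_sum, map_sum, add_assoc, Finset.sum_range_add,
    Finset.sum_eq_zero fun k hk => by
      rw [Nat.choose_eq_zero_of_lt (Finset.mem_range.1 hk)]; simp, zero_add]
  refine Finset.sum_congr rfl fun i hi => ?_
  have hi : i ≤ n := Nat.le_of_lt_succ (Finset.mem_range.1 hi)
  have hchoose := Nat.choose_mul (n := m + n) (k := m + i) (s := m) (by lia)
  rw [Nat.add_sub_cancel_left, Nat.add_sub_cancel_left] at hchoose
  have hchoose' : ((m + n).choose (m + i) : ℝ) * (m + i).choose m =
      (m + n).choose m * n.choose i := by exact_mod_cast hchoose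
  have hpoly : (X ^ m * (X ^ i * (1 - X) ^ (n - i) * (n.choose i : ℝ[X]))) =
      (n.choose i : ℝ) • (X ^ (m + i) * (1 - X : ℝ[X]) ^ (n - i)) := by
    rw [smul_eq_C_mul, C_eq_natCast, pow_add]
    ring
  rw [hpoly, map_smul, momentFunctional_X_pow_mul_one_sub_X_pow, Nat.add_sub_add_left, smul_eq_mul]
  field_simp
  linear_combination nablaIter x (n - i) (m + i) * hchoose'

/-- The quotient is a product of factors `(k - i) / (N - i)` for `i < m`, each within `i / N` of `k
/ N`; the errors add up because all factors lie in `[0, 1]`. -/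
lemma abs_choose_div_choose_sub_pow_le {k N : ℕ} (hk : k ≤ N) (m : ℕ) (hm : m ≤ N) :
    |(k.choose m : ℝ) / N.choose m - ((k : ℝ) / N) ^ m| ≤ (m : ℝ) * m / N := by
  have hdesc : ∀ m, (k.choose m : ℝ) / N.choose m = (k.descFactorial m : ℝ) / N.descFactorial m :=
    fun m => by
      rw [Nat.descFactorial_eq_factorial_mul_choose, Nat.descFactorial_eq_factorial_mul_choose]
      push_cast
      rw [mul_div_mul_left _ _ (by positivity)]
  rw [hdesc]
  induction m with
  | zero => simp
  | succ m ih =>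
    have ih := ih (by lia)
    have hN : (0 : ℝ) < N := by exact_mod_cast (by lia : 0 < N)
    have hNm : (0 : ℝ) < (N - m : ℕ) := by exact_mod_cast (by lia : 0 < N - m)
    set r : ℝ := (k.descFactorial m : ℝ) / N.descFactorial m
    set q : ℝ := (k : ℝ) / N
    set a : ℝ := ((k - m : ℕ) : ℝ) / (N - m : ℕ) with ha
    have hr0 : 0 ≤ r := by positivity
    have hr1 : r ≤ 1 := div_le_one_of_le₀
      (by exact_mod_cast Nat.descFactorial_le m hk) (by positivity)
    have hq0 : 0 ≤ q := by positivity
    have hq1 : q ≤ 1 := div_le_one_of_le₀ (by exact_mod_cast hk) (by positivity)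
    have haq : |a - q| ≤ m / N := by
      -- For `k ≤ m` truncated subtraction gives `a = 0`, and then `q ≤ m / N`.
      rcases le_total k m with hkm | hkm
      · rw [ha, Nat.sub_eq_zero_of_le hkm]
        simp only [Nat.cast_zero, zero_div, zero_sub, abs_neg]
        rw [abs_of_nonneg hq0]
        exact div_le_div_of_nonneg_right (by exact_mod_cast hkm) hN.le
      · have hkN : (k : ℝ) ≤ N := by exact_mod_cast hk
        have hmk : (m : ℝ) ≤ k := by exact_mod_cast hkm
        rw [Nat.cast_sub (by lia)] at hNm
        have : a - q = -(m / N * ((N - k) / (N - m))) := by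
          simp only [ha, q]
          rw [Nat.cast_sub hkm, Nat.cast_sub (by lia)]
          field_simp
          ring
        rw [this, abs_neg, abs_of_nonneg
          (mul_nonneg (by positivity) (div_nonneg (by linarith) hNm.le))]
        exact mul_le_of_le_one_right (by positivity) ((div_le_one hNm).2 (by linarith))
    have hsplit : (k.descFactorial (m + 1) : ℝ) / N.descFactorial (m + 1) - q ^ (m + 1) =
        (a - q) * r + q * (r - q ^ m) := by
      have : (k.descFactorial (m + 1) : ℝ) / N.descFactorial (m + 1) = a * r := by
        rw [Nat.descFactorial_succ, Nat.descFactorial_succ, Nat.cast_mul, Nat.cast_mul,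
          mul_div_mul_comm]
      rw [this]
      ring
    rw [hsplit]
    calc |(a - q) * r + q * (r - q ^ m)| ≤ |a - q| * r + q * |r - q ^ m| := by
          refine (abs_add_le _ _).trans_eq ?_
          rw [abs_mul, abs_mul, abs_of_nonneg hr0, abs_of_nonneg hq0]
      _ ≤ m / N + m * m / N := add_le_add
          ((mul_le_of_le_one_right (abs_nonneg _) hr1).trans haq)
          ((mul_le_of_le_one_left (abs_nonneg _) hq1).trans ih)
      _ ≤ ((m + 1 : ℕ) : ℝ) * (m + 1 : ℕ) / N := by
          rw [← add_div]
          refine div_le_div_of_nonneg_right ?_ hN.le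
          push_cast
          nlinarith [(Nat.cast_nonneg m : (0 : ℝ) ≤ m)]

/-- A discrete probability measure on `[0, 1]` whose `m`-th moment is close to `x m`. -/
lemma exists_probabilityMeasure_moments_near {x : ℕ → ℝ} (h0 : x 0 = 1)
    (h : IsCompletelyMonotoneSeq x) (N : ℕ) :
    ∃ μ : ProbabilityMeasure I, ∀ m ≤ N,
      |∫ t, (t : ℝ) ^ m ∂(μ : Measure I) - x m| ≤ (m : ℝ) * m / N := by
  -- Mass `w k` at `k / N`: for a moment sequence, `w k` is the integral of the Bernstein polynomial
  -- `N.choose k * t ^ k * (1 - t) ^ (N - k)`.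
  set w : ℕ → ℝ := fun k => N.choose k * nablaIter x (N - k) k
  have hw : ∀ k, 0 ≤ w k := fun k => mul_nonneg (Nat.cast_nonneg _) (h _ _)
  have hw1 : ∑ k ∈ Finset.range (N + 1), w k = 1 := by
    simpa [h0] using sum_choose_mul_nablaIter x N.zero_le
  set p : ℕ → I := fun k => Set.projIcc 0 1 zero_le_one ((k : ℝ) / N)
  have hp : ∀ k ≤ N, (p k : ℝ) = k / N := fun k hk => by
    have hmem : (k : ℝ) / N ∈ Set.Icc (0 : ℝ) 1 :=
      ⟨by positivity, div_le_one_of_le₀ (by exact_mod_cast hk) (by positivity)⟩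
    simp only [p, Set.projIcc_of_mem zero_le_one hmem]
  set μ : Measure I := ∑ k ∈ Finset.range (N + 1), ENNReal.ofReal (w k) • Measure.dirac (p k)
  have hμ : IsProbabilityMeasure μ := ⟨by
    simp only [μ, Measure.finsetSum_apply, Measure.smul_apply, measure_univ, smul_eq_mul, mul_one]
    rw [← ENNReal.ofReal_sum_of_nonneg fun k _ => hw k, hw1, ENNReal.ofReal_one]⟩
  refine ⟨⟨μ, hμ⟩, fun m hm => ?_⟩
  have hint : ∫ t, (t : ℝ) ^ m ∂μ = ∑ k ∈ Finset.range (N + 1), w k * (p k : ℝ) ^ m := by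
    rw [integral_finsetSum_measure]
    · refine Finset.sum_congr rfl fun k _ => ?_
      rw [integral_smul_measure, integral_dirac, ENNReal.toReal_ofReal (hw k), smul_eq_mul]
    · intro k _
      exact (integrable_dirac (by simp)).smul_measure ENNReal.ofReal_ne_top
  change |∫ t, (t : ℝ) ^ m ∂μ - x m| ≤ _
  rw [hint, ← sum_choose_mul_nablaIter x hm, ← Finset.sum_sub_distrib]
  calc _ ≤ ∑ k ∈ Finset.range (N + 1), w k * ((m : ℝ) * m / N) := by
        refine (Finset.abs_sum_le_sum_abs _ _).trans (Finset.sum_le_sum fun k hk => ?_)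
        have hk : k ≤ N := Nat.le_of_lt_succ (Finset.mem_range.1 hk)
        rw [← mul_sub, abs_mul, abs_of_nonneg (hw k), abs_sub_comm, hp k hk]
        exact mul_le_mul_of_nonneg_left (abs_choose_div_choose_sub_pow_le hk m hm) (hw k)
    _ = (m : ℝ) * m / N := by rw [← Finset.sum_mul, hw1, one_mul]

/-- Hausdorff's theorem: a completely monotone sequence starting with `1` is the moment sequence
of a probability measure on `[0, 1]`. -/
theorem exists_probabilityMeasure_moments_eq {x : ℕ → ℝ} (h0 : x 0 = 1)
    (h : IsCompletelyMonotoneSeq x) :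
    ∃ μ : ProbabilityMeasure I, ∀ m, ∫ t, (t : ℝ) ^ m ∂(μ : Measure I) = x m := by
  choose μ hμ using exists_probabilityMeasure_moments_near h0 h
  -- Probability measures on `[0, 1]` are weakly compact; an ultrafilter gives a limit without
  -- extracting a subsequence.
  let 𝒰 : Ultrafilter ℕ := hyperfilter ℕ
  obtain ⟨ν, -, hν⟩ := isCompact_univ.ultrafilter_le_nhds (𝒰.map μ) (by simp)
  refine ⟨ν, fun m => ?_⟩
  have hlim : Tendsto (fun N => ∫ t, (t : ℝ) ^ m ∂(μ N : Measure I)) 𝒰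
      (𝓝 (∫ t, (t : ℝ) ^ m ∂(ν : Measure I))) :=
    ProbabilityMeasure.tendsto_iff_forall_integral_tendsto.1 (show Tendsto μ 𝒰 (𝓝 ν) from hν)
      (BoundedContinuousFunction.mkOfCompact ⟨fun t : I => (t : ℝ) ^ m, by fun_prop⟩)
  refine tendsto_nhds_unique hlim (Tendsto.mono_left ?_ Nat.hyperfilter_le_atTop)
  rw [tendsto_iff_norm_sub_tendsto_zero]
  refine squeeze_zero' (.of_forall fun _ => norm_nonneg _)
    ((eventually_ge_atTop m).mono fun N hN => hμ N m hN) ?_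
  exact tendsto_const_div_atTop_nhds_zero_nat _

/-- Moment sequences of measures on `[0, 1]` are completely monotone. -/
lemma isCompletelyMonotoneSeq_integral_pow {α : Type*} [MeasurableSpace α] (μ : Measure α)
    [IsFiniteMeasure μ] {f : α → ℝ} (hf : Measurable f) (h0 : ∀ a, 0 ≤ f a) (h1 : ∀ a, f a ≤ 1) :
    IsCompletelyMonotoneSeq fun k => ∫ a, f a ^ k ∂μ := by
  intro k j
  have hint : ∀ k, Integrable (fun a => f a ^ k) μ := fun k =>
    .of_bound (hf.pow_const k).aestronglyMeasurable 1 <| .of_forall fun a => by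
      rw [Real.norm_of_nonneg (pow_nonneg (h0 a) k)]
      exact pow_le_one₀ (h0 a) (h1 a)
  have : nablaIter (fun k => ∫ a, f a ^ k ∂μ) j k = ∫ a, f a ^ k * (1 - f a) ^ j ∂μ := by
    simp only [nablaIter, ← integral_const_mul]
    rw [← integral_finsetSum _ fun i _ => (hint _).const_mul _]
    refine integral_congr_ae (.of_forall fun a => ?_)
    have := congrArg (eval (f a)) (one_sub_X_pow_eq_sum j)
    simp only [eval_pow, eval_sub, eval_one, eval_X, eval_finsetSum, eval_monomial] at this
    simp only [this, Finset.mul_sum]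
    exact Finset.sum_congr rfl fun i _ => by ring
  rw [this]
  exact integral_nonneg fun a => mul_nonneg (pow_nonneg (h0 a) k) (pow_nonneg (by linarith [h1 a]) j)

/-- Finite measures on `[0, 1]` are determined by their moments. -/
lemma measure_unitInterval_ext_of_moments {μ ν : Measure I} [IsFiniteMeasure μ] [IsFiniteMeasure ν]
    (h : ∀ m : ℕ, ∫ t, (t : ℝ) ^ m ∂μ = ∫ t, (t : ℝ) ^ m ∂ν) : μ = ν := by
  refine ext_of_forall_integral_eq_of_IsFiniteMeasure fun f => ?_
  have hint : ∀ (ρ : Measure I) [IsFiniteMeasure ρ] (g : C(I, ℝ)), Integrable g ρ := fun ρ _ g =>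
    (BoundedContinuousFunction.mkOfCompact g).integrable ρ
  have hpoly : ∀ p : ℝ[X], ∫ t : I, p.eval (t : ℝ) ∂μ = ∫ t : I, p.eval (t : ℝ) ∂ν := fun p => by
    have hsum : ∀ (ρ : Measure I) [IsFiniteMeasure ρ], ∫ t : I, p.eval (t : ℝ) ∂ρ =
        ∑ i ∈ Finset.range (p.natDegree + 1), p.coeff i * ∫ t : I, (t : ℝ) ^ i ∂ρ := fun ρ _ => by
      simp only [eval_eq_sum_range, ← integral_const_mul]
      exact integral_finsetSum _ fun i _ =>
        (hint ρ ⟨fun t : I => (t : ℝ) ^ i, by fun_prop⟩).const_mul _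
    rw [hsum, hsum]
    simp only [h]
  have hcont : ∀ (ρ : Measure I) [IsFiniteMeasure ρ],
      Continuous fun g : C(I, ℝ) => ∫ t, g t ∂ρ := fun ρ _ => by
    let L : C(I, ℝ) →ₗ[ℝ] ℝ :=
      { toFun := fun g => ∫ t, g t ∂ρ
        map_add' := fun g g' => integral_add (hint ρ g) (hint ρ g')
        map_smul' := fun c g => integral_const_mul c _ }
    refine (L.mkContinuous (ρ.real Set.univ) fun g => ?_).continuous
    rw [mul_comm]
    exact norm_integral_le_of_norm_le_const (.of_forall g.norm_coe_le_norm)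
  -- The functions with equal integrals form a sup-norm closed set containing the polynomials, hence
  -- everything by Weierstrass.
  have hclosed : IsClosed {g : C(I, ℝ) | ∫ t, g t ∂μ = ∫ t, g t ∂ν} :=
    isClosed_eq (hcont μ) (hcont ν)
  have hmem : (f : C(I, ℝ)) ∈ (polynomialFunctions I).topologicalClosure := by
    rw [polynomialFunctions_closure_eq_top']
    trivial
  refine closure_minimal ?_ hclosed hmem
  rintro _ ⟨p, -, rfl⟩
  exact hpoly p

/-! ### The change of variables `t = e^{-x}` between `[0, ∞]` and `[0, 1]` -/

lemma expNeg_top : expNeg ⊤ = 0 := if_pos rfl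

lemma expNeg_of_ne_top {x : ℝ≥0∞} (hx : x ≠ ⊤) : expNeg x = Real.exp (-x.toReal) := if_neg hx

lemma expNeg_zero : expNeg 0 = 1 := by simp [expNeg]

lemma expNeg_nonneg (x : ℝ≥0∞) : 0 ≤ expNeg x := by
  unfold expNeg
  split_ifs
  exacts [le_rfl, (Real.exp_pos _).le]

lemma expNeg_le_one (x : ℝ≥0∞) : expNeg x ≤ 1 := by
  unfold expNeg
  split_ifs
  exacts [zero_le_one, Real.exp_le_one_iff.2 (by simp)]

lemma measurable_expNeg : Measurable expNeg :=
  Measurable.ite (measurableSet_singleton _) measurable_const (by fun_prop)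

lemma expNeg_add (x y : ℝ≥0∞) : expNeg (x + y) = expNeg x * expNeg y := by
  rcases eq_or_ne x ⊤ with rfl | hx
  · simp [expNeg_top]
  rcases eq_or_ne y ⊤ with rfl | hy
  · simp [expNeg_top]
  rw [expNeg_of_ne_top hx, expNeg_of_ne_top hy, expNeg_of_ne_top (ENNReal.add_ne_top.2 ⟨hx, hy⟩),
    ENNReal.toReal_add hx hy, neg_add, Real.exp_add]

lemma expNeg_sum {ι : Type*} (s : Finset ι) (x : ι → ℝ≥0∞) :
    expNeg (∑ i ∈ s, x i) = ∏ i ∈ s, expNeg (x i) := by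
  classical
  induction s using Finset.induction_on with
  | empty => simp [expNeg_zero]
  | insert a s ha ih => rw [Finset.sum_insert ha, Finset.prod_insert ha, expNeg_add, ih]

lemma expNeg_natCast_mul (k : ℕ) (x : ℝ≥0∞) : expNeg (k * x) = expNeg x ^ k := by
  rw [← nsmul_eq_mul, ← Finset.card_range k, ← Finset.sum_const, expNeg_sum, Finset.prod_const]

/-- The map `t ↦ -log t` from `[0, 1]` to `[0, ∞]`, with value `∞` at `0`. -/
noncomputable def negLog (t : I) : ℝ≥0∞ :=
  if (t : ℝ) = 0 then ⊤ else ENNReal.ofReal (-Real.log t)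

lemma measurable_negLog : Measurable negLog :=
  Measurable.ite (measurable_subtype_coe (measurableSet_singleton 0)) measurable_const
    (by fun_prop)

lemma expNeg_negLog (t : I) : expNeg (negLog t) = t := by
  unfold negLog
  split_ifs with ht
  · rw [expNeg_top, ht]
  · rw [expNeg_of_ne_top ENNReal.ofReal_ne_top, ENNReal.toReal_ofReal
      (neg_nonneg.2 (Real.log_nonpos t.2.1 t.2.2)), neg_neg,
      Real.exp_log (lt_of_le_of_ne t.2.1 (Ne.symm ht))]

lemma negLog_expNeg (x : ℝ≥0∞) : negLog ⟨expNeg x, expNeg_nonneg x, expNeg_le_one x⟩ = x := by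
  unfold negLog
  rcases eq_or_ne x ⊤ with rfl | hx
  · simp [expNeg_top]
  · simp [expNeg_of_ne_top hx, Real.exp_ne_zero, hx]

/-- Every completely monotone sequence starting with `1` is the restriction to `ℕ` of the Laplace
transform of a probability measure on `[0, ∞]`. -/
lemma exists_laplace_eq {x : ℕ → ℝ} (h0 : x 0 = 1) (h : IsCompletelyMonotoneSeq x) :
    ∃ κ : Measure ℝ≥0∞, IsProbabilityMeasure κ ∧
      ∀ k : ℕ, x k = ∫ y, expNeg ((k : ℝ≥0∞) * y) ∂κ := by
  obtain ⟨μ, hμ⟩ := exists_probabilityMeasure_moments_eq h0 h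
  refine ⟨(μ : Measure I).map negLog,
    Measure.isProbabilityMeasure_map measurable_negLog.aemeasurable, fun k => ?_⟩
  simp only [expNeg_natCast_mul]
  rw [integral_map measurable_negLog.aemeasurable
    (measurable_expNeg.pow_const k).aestronglyMeasurable]
  simp only [expNeg_negLog, hμ]

/-- Finite measures on `[0, ∞]` are determined by their Laplace transform on `ℕ`. -/
lemma measure_ext_of_laplace {κ κ' : Measure ℝ≥0∞} [IsFiniteMeasure κ] [IsFiniteMeasure κ']
    (h : ∀ k : ℕ, ∫ y, expNeg ((k : ℝ≥0∞) * y) ∂κ = ∫ y, expNeg ((k : ℝ≥0∞) * y) ∂κ') :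
    κ = κ' := by
  let φ : ℝ≥0∞ → I := fun x => ⟨expNeg x, expNeg_nonneg x, expNeg_le_one x⟩
  have hφ : Measurable φ := measurable_expNeg.subtype_mk
  have hmap : κ.map φ = κ'.map φ := measure_unitInterval_ext_of_moments fun m => by
    rw [integral_map hφ.aemeasurable (by fun_prop), integral_map hφ.aemeasurable (by fun_prop)]
    simpa only [expNeg_natCast_mul] using h m
  -- Since `negLog` is a left inverse of `φ`, pushing forward along it recovers the original
  -- measures.
  have hid : negLog ∘ φ = id := funext negLog_expNeg
  simpa [Measure.map_map measurable_negLog hφ, hid] using congrArg (Measure.map negLog) hmap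

/-- The Laplace transform of a sum of independent variables is the product of the transforms. -/
lemma integral_expNeg_map_sum {ι Ω : Type*} [Fintype ι] [MeasurableSpace Ω] {P : Measure Ω}
    {Y : ι → Ω → ℝ≥0∞} (hY : ∀ i, Measurable (Y i)) (hind : iIndepFun Y P) (k : ℕ) :
    ∫ y, expNeg ((k : ℝ≥0∞) * y) ∂(P.map fun ω => ∑ i, Y i ω) =
      ∏ i, ∫ y, expNeg ((k : ℝ≥0∞) * y) ∂(P.map (Y i)) := by
  have hm : Measurable fun y : ℝ≥0∞ => expNeg ((k : ℝ≥0∞) * y) :=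
    measurable_expNeg.comp (measurable_const_mul _)
  rw [integral_map (Finset.measurable_fun_sum _ fun i _ => hY i).aemeasurable
    hm.aestronglyMeasurable]
  simp only [Finset.mul_sum, expNeg_sum]
  rw [hind.integral_fun_prod_comp (f := fun _ y => expNeg ((k : ℝ≥0∞) * y))
    (fun i => (hY i).aemeasurable) fun i => hm.aestronglyMeasurable]
  exact Finset.prod_congr rfl fun i _ =>
    (integral_map (hY i).aemeasurable hm.aestronglyMeasurable).symm

/-- A law is infinitely divisible if its Laplace transform on `ℕ` has `n`-th roots that are
Laplace transforms of probability laws. -/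
lemma isInfDivLaw_of_laplace {κ : Measure ℝ≥0∞} [IsProbabilityMeasure κ]
    (h : ∀ n : ℕ, 2 ≤ n → ∃ ν : Measure ℝ≥0∞, IsProbabilityMeasure ν ∧ ∀ k : ℕ,
      (∫ y, expNeg ((k : ℝ≥0∞) * y) ∂ν) ^ n = ∫ y, expNeg ((k : ℝ≥0∞) * y) ∂κ) :
    IsInfDivLaw κ := by
  intro n hn
  obtain ⟨ν, hν, hlap⟩ := h n hn
  have hmeas : ∀ i : Fin n, Measurable fun ω : Fin n → ℝ≥0∞ => ω i := measurable_pi_apply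
  have hmap : ∀ i : Fin n, (Measure.pi fun _ : Fin n => ν).map (fun ω => ω i) = ν := fun i =>
    (measurePreserving_eval (fun _ : Fin n => ν) i).map_eq
  have hind : iIndepFun (fun (i : Fin n) (ω : Fin n → ℝ≥0∞) => ω i)
      (Measure.pi fun _ : Fin n => ν) :=
    iIndepFun_pi (X := fun _ => id) fun _ => aemeasurable_id
  refine ⟨Fin n → ℝ≥0∞, inferInstance, Measure.pi fun _ => ν, fun i ω => ω i, inferInstance,
    hmeas, hind, fun i j => ⟨(hmeas i).aemeasurable, (hmeas j).aemeasurable, ?_⟩, ?_⟩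
  · rw [hmap, hmap]
  · have : IsProbabilityMeasure ((Measure.pi fun _ : Fin n => ν).map fun ω => ∑ i, ω i) :=
      Measure.isProbabilityMeasure_map (by fun_prop)
    refine measure_ext_of_laplace fun k => ?_
    rw [integral_expNeg_map_sum hmeas hind, ← hlap]
    simp only [hmap, Finset.prod_const, Finset.card_univ, Fintype.card_fin]

/-- The Laplace transform of an infinitely divisible law has `n`-th roots that are Laplace
transforms of probability laws. -/
lemma IsInfDivLaw.exists_laplace_pow_eq {κ : Measure ℝ≥0∞} [IsProbabilityMeasure κ]
    (h : IsInfDivLaw κ) {n : ℕ} (hn : 1 ≤ n) :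
    ∃ ν : Measure ℝ≥0∞, IsProbabilityMeasure ν ∧ ∀ k : ℕ,
      (∫ y, expNeg ((k : ℝ≥0∞) * y) ∂ν) ^ n = ∫ y, expNeg ((k : ℝ≥0∞) * y) ∂κ := by
  -- `IsInfDivLaw` starts at `n = 2`; for `n = 1` the law `κ` itself serves.
  obtain rfl | hn := hn.eq_or_lt
  · exact ⟨κ, inferInstance, fun k => pow_one _⟩
  obtain ⟨Ω, _, P, Y, hP, hY, hind, hid, rfl⟩ := h n hn
  let i₀ : Fin n := ⟨0, by lia⟩
  refine ⟨P.map (Y i₀), Measure.isProbabilityMeasure_map (hY i₀).aemeasurable, fun k => ?_⟩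
  rw [integral_expNeg_map_sum hY hind]
  simp only [(hid _ i₀).map_eq, Finset.prod_const, Finset.card_univ, Fintype.card_fin]

lemma integrable_expNeg (κ : Measure ℝ≥0∞) [IsFiniteMeasure κ] : Integrable expNeg κ :=
  .of_bound measurable_expNeg.aestronglyMeasurable 1 <| .of_forall fun x => by
    rw [Real.norm_of_nonneg (expNeg_nonneg x)]
    exact expNeg_le_one x

lemma expNeg_eq_zero_iff {x : ℝ≥0∞} : expNeg x = 0 ↔ x = ⊤ := by
  simp [expNeg, Real.exp_ne_zero]

lemma expNeg_eq_one_iff {x : ℝ≥0∞} : expNeg x = 1 ↔ x = 0 := by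
  by_cases hx : x = ⊤ <;> simp [expNeg, hx, ENNReal.toReal_eq_zero_iff]

lemma measure_singleton_lt_one_iff {κ : Measure ℝ≥0∞} [IsProbabilityMeasure κ] {a : ℝ≥0∞} :
    κ {a} < 1 ↔ ¬ ∀ᵐ x ∂κ, x = a := by
  rw [lt_iff_le_and_ne, and_iff_right prob_le_one, Ne, ← mem_ae_iff_prob_eq_one
    (measurableSet_singleton a)]
  rfl

/-- The nonnegative function `1 - expNeg x` has zero integral only if `x = 0` almost surely. -/
lemma integral_expNeg_lt_one_iff {κ : Measure ℝ≥0∞} [IsProbabilityMeasure κ] :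
    ∫ x, expNeg x ∂κ < 1 ↔ κ {0} < 1 := by
  have hint : Integrable (fun x => 1 - expNeg x) κ := (integrable_const 1).sub (integrable_expNeg κ)
  have hnn : 0 ≤ fun x => 1 - expNeg x := fun x => sub_nonneg.2 (expNeg_le_one x)
  have heq : ∫ x, (1 - expNeg x) ∂κ = 1 - ∫ x, expNeg x ∂κ := by
    rw [integral_sub (integrable_const 1) (integrable_expNeg κ)]
    simp
  rw [measure_singleton_lt_one_iff, ← sub_pos, ← heq,
    (integral_nonneg hnn).lt_iff_ne', Ne, integral_eq_zero_iff_of_nonneg hnn hint]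
  refine not_congr (eventually_congr (.of_forall fun x => ?_))
  rw [Pi.zero_apply, sub_eq_zero, eq_comm, expNeg_eq_one_iff]

lemma integral_expNeg_pos_iff {κ : Measure ℝ≥0∞} [IsProbabilityMeasure κ] :
    0 < ∫ x, expNeg x ∂κ ↔ κ {⊤} < 1 := by
  rw [measure_singleton_lt_one_iff, (integral_nonneg expNeg_nonneg).lt_iff_ne', Ne,
    integral_eq_zero_iff_of_nonneg expNeg_nonneg (integrable_expNeg κ)]
  refine not_congr (eventually_congr (.of_forall fun x => ?_))
  rw [Pi.zero_apply, expNeg_eq_zero_iff]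

/-! ### The equivalence -/

lemma exists_isInfDivLaw_of_rpow_mem_CMSeq {b : ℕ → ℝ} (hb : ∀ k, 0 < b k)
    (h : ∀ n : ℕ, 1 ≤ n → (fun k => b k ^ (1 / (n : ℝ))) ∈ CMSeq) :
    ∃ κ : Measure ℝ≥0∞, IsProbabilityMeasure κ ∧ IsInfDivLaw κ ∧ κ {0} < 1 ∧ κ {⊤} < 1 ∧
      ∀ k : ℕ, b k = ∫ x, expNeg ((k : ℝ≥0∞) * x) ∂κ := by
  obtain ⟨h0, h1, hcm⟩ : b ∈ CMSeq := by simpa using h 1 le_rfl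
  -- The case `n = 1` supplies `κ`; the other `n` supply the laws of its summands.
  obtain ⟨κ, hκ, hlap⟩ := exists_laplace_eq h0 hcm
  have hlap1 : b 1 = ∫ x, expNeg x ∂κ := by simpa using hlap 1
  refine ⟨κ, hκ, isInfDivLaw_of_laplace fun n hn => ?_,
    integral_expNeg_lt_one_iff.1 (hlap1 ▸ h1), integral_expNeg_pos_iff.1 (hlap1 ▸ hb 1), hlap⟩
  obtain ⟨hn0, -, hncm⟩ := h n (by lia)
  obtain ⟨ν, hν, hνlap⟩ := exists_laplace_eq hn0 hncm
  refine ⟨ν, hν, fun k => ?_⟩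
  rw [← hνlap, ← hlap, one_div, Real.rpow_inv_natCast_pow (hb k).le (by lia)]

lemma rpow_mem_CMSeq_of_isInfDivLaw {b : ℕ → ℝ} {κ : Measure ℝ≥0∞} [IsProbabilityMeasure κ]
    (hκ : IsInfDivLaw κ) (h0 : κ {0} < 1)
    (hlap : ∀ k : ℕ, b k = ∫ x, expNeg ((k : ℝ≥0∞) * x) ∂κ) {n : ℕ} (hn : 1 ≤ n) :
    (fun k => b k ^ (1 / (n : ℝ))) ∈ CMSeq := by
  obtain ⟨ν, hν, hpow⟩ := hκ.exists_laplace_pow_eq hn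
  have hroot : ∀ k : ℕ, b k ^ (1 / (n : ℝ)) = ∫ x, expNeg x ^ k ∂ν := fun k => by
    rw [hlap, ← hpow, one_div, Real.pow_rpow_inv_natCast
      (integral_nonneg fun x => expNeg_nonneg _) (by lia)]
    simp only [expNeg_natCast_mul]
  have hb0 : b 0 = 1 := by simp [hlap, expNeg_zero]
  have hb1 : b 1 = ∫ x, expNeg x ∂κ := by simpa using hlap 1
  refine ⟨by simp [hb0], Real.rpow_lt_one ?_ ?_ (by positivity), ?_⟩
  · exact hb1 ▸ integral_nonneg expNeg_nonneg
  · exact hb1 ▸ integral_expNeg_lt_one_iff.2 h0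
  · simp only [hroot]
    exact isCompletelyMonotoneSeq_integral_pow ν measurable_expNeg expNeg_nonneg expNeg_le_one

theorem proposition11 (b : ℕ → ℝ) (hb : ∀ k, 0 < b k) :
    List.TFAE
      [ b ∈ LogCMSeq,
        ∃ κ : Measure ℝ≥0∞, IsProbabilityMeasure κ ∧ IsInfDivLaw κ ∧
          κ {0} < 1 ∧ κ {⊤} < 1 ∧
          ∀ k : ℕ, b k = ∫ x, expNeg ((k : ℝ≥0∞) * x) ∂κ,
        ∀ r : ℝ, 0 < r → (fun k => b k ^ r) ∈ CMSeq,
        ∀ n : ℕ, 1 ≤ n → (fun k => b k ^ (1 / (n : ℝ))) ∈ CMSeq ] := by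
  tfae_have 1 → 3 := fun h r hr => rpow_mem_CMSeq_of_mem_LogCMSeq h hr
  tfae_have 3 → 4 := fun h n hn => h _ (by positivity)
  tfae_have 4 → 1 := mem_LogCMSeq_of_rpow_mem_CMSeq hb
  tfae_have 4 → 2 := exists_isInfDivLaw_of_rpow_mem_CMSeq hb
  tfae_have 2 → 4 := fun ⟨_, _, hκ, h0, _, hlap⟩ _ hn => rpow_mem_CMSeq_of_isInfDivLaw hκ h0 hlap hn
  tfae_finish
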